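/- Let $G$ be a group with a finite generating set $X\subseteq G$, let $A = X\cup X^{-1}\subseteq G$ be totally ordered, and let $A^*$ be the set of words over $A$. For $w\in A^*$ write $l(w)$ for its length, $\overline w\in G$ for the element it represents, and $w(i)$ for its prefix of length $i$ (with $w(i)=w$ for $i\ge l(w)$). A word is geodesic if it has minimal length among the words representing the same element. A two-variable automaton reads a pair $(u,v)$ of words as the padded pair $(u,v)^\dagger$ over $A^\dagger=A\cup\{\$\}$, in which the shorter word is extended at its end by the symbol $\$$, representing $1_G$. The word-differences arising from $(u,v)$ are the elements $\overline{u(i)}^{-1}\,\overline{v(i)}$, $i\ge 0$. An automatic structure for $G$ with respect to $X$ consists of finite state automata $W$ over $A$ and $M_x$ over $A^\dagger\times A^\dagger$ for $x\in A\cup\{1_G\}$, such that every element of $G$ is represented by a word in $L(W)$, and $M_x$ accepts exactly the padded pairs $(w_1,w_2)^\dagger$ with $w_1,w_2\in L(W)$ and $\overline{w_1}\,x=\overline{w_2}$. It is short-lex if $L(W)$ is the set of short-lex least representatives of the elements of $G$. The group $G$ is strongly geodesically automatic with respect to $X$ if it has an automatic structure with respect to $X$ for which $L(W)$ is the set of all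 geodesic words. Suppose that a short-lex automatic structure $\{W, M_x\}$ for $G$ with respect to $X$ is given, and consider the following procedure. Let $\mathcal{WD}_1$ be the set of all word-differences arising from the pairs accepted by the multipliers $M_x$, $x\in A\cup\{1_G\}$. For $n\ge 1$, let $WD_n$ be the two-variable automaton with state set $\mathcal{WD}_n$, initial state and only accepting state $1_G$, and a transition $d\to e$ with label $(x,y)$ whenever $d,e\in\mathcal{WD}_n$, $x,y\in A^\dagger$ and $x^{-1}dy=e$ in $G$; let $GE_n$, $GW_n$, $T_n$ be finite state automata with $$L(GE_n)=\{(u,v) : (u,v)\in L(WD_n),\ v\in L(W),\ l(u)=l(v)\},$$ $$L(GW_n)=\{u\in A^* : \exists v\in A^*,\ (u,v)\in L(GE_n)\},$$ $$L(T_n)=\{w\in A^*\setminus L(GW_n) : \exists u,\ (w,u)\in L(WD_n),\ u\in L(GW_n),\ l(u)=l(w)\}.$$ If $L(T_n)$ is empty, the procedure halts. Otherwise choose any word $w\in L(T_n)$, let $v$ be its short-lex least representative, let $\mathcal{WD}_{n+1}$ be the union of $\mathcal{WD}_n$ and the set of word-differences arising from $(w,v)$, and continue with $n+1$ in place of $n$.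 Theorem. This procedure can be carried out: at every stage $\mathcal{WD}_n$ is finite, the languages above are regular (so that the automata exist), and the choices required are possible. Whatever choices are made, the procedure halts (that is, $L(T_n)$ is empty for some $n$) if and only if $G$ is strongly geodesically automatic with respect to $X$. -/

import Mathlib

namespace GeodAut

universe u

variable {G : Type u} [Group G]

/-- The alphabet `A = X ∪ X⁻¹`, as a subset of the group. -/
abbrev Alphabet (X : Set G) : Type u := ↥(X ∪ X⁻¹)

/-- The padded alphabet `A† = A ∪ {$}`; the padding symbol `$` is `none`. -/
abbrev PadAlphabet (X : Set G) : Type u := Option (Alphabet X)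

variable {X : Set G}

/-- The element of `G` represented by a word in `A`. -/
def eval (w : List (Alphabet X)) : G := (w.map Subtype.val).prod

/-- The element of `G` represented by a symbol of `A†`; the symbol `$` maps to the identity. -/
def symVal : PadAlphabet X → G
  | none => 1
  | some a => a.1

/-- The padded pair `(u, v)†`: the shorter word is filled up with `$` at its end. -/
def pad (u v : List (Alphabet X)) : List (PadAlphabet X × PadAlphabet X) :=
  List.zipWithAll Prod.mk u v

/-- The geodesic words: the words of minimal length among those representing the same element. -/
def geodesicWords (X : Set G) : Language (Alphabet X) :=
  {w | ∀ v : List (Alphabet X), eval v = eval w → w.length ≤ v.length}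

/-- The short-lex least representatives of the group elements: lexicographically least among the
shortest words representing the same element. -/
def shortLexWords (X : Set G) [LinearOrder (Alphabet X)] : Language (Alphabet X) :=
  {w | ∀ v : List (Alphabet X), eval v = eval w → w = v ∨ List.Shortlex (· < ·) w v}

/-- The set of word-differences `u(i)⁻¹ v(i)` arising from a pair of words, where `u(i)` is the
prefix of `u` of length `i` (and `u` itself for `i ≥ l(u)`). -/
def wordDiffs (u v : List (Alphabet X)) : Set G :=
  {g | ∃ i : ℕ, g = (eval (u.take i))⁻¹ * eval (v.take i)}

/-- An automatic structure for `G` with respect to `X`: finite state automata `W` (the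
word-acceptor) and `M x` (the multipliers). There is one multiplier for each letter of `A` and one
for the identity element, so that they are indexed by `A ∪ {$}`, with `$` standing for `1`. -/
structure AutomaticStructure (X : Set G) where
  WState : Type
  finite_WState : Finite WState
  W : DFA (Alphabet X) WState
  exists_rep : ∀ g : G, ∃ w ∈ W.accepts, eval w = g
  MState : PadAlphabet X → Type
  finite_MState : ∀ x, Finite (MState x)
  M : ∀ x : PadAlphabet X, DFA (PadAlphabet X × PadAlphabet X) (MState x)
  mem_M : ∀ (x : PadAlphabet X) (p : List (PadAlphabet X × PadAlphabet X)),
    p ∈ (M x).accepts ↔ ∃ w₁ w₂ : List (Alphabet X), p = pad w₁ w₂ ∧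
      w₁ ∈ W.accepts ∧ w₂ ∈ W.accepts ∧ eval w₁ * symVal x = eval w₂

/-- `G` is strongly geodesically automatic with respect to `X`: there is an automatic structure
whose word-acceptor accepts exactly the geodesic words. -/
def StronglyGeodesicallyAutomatic (X : Set G) : Prop :=
  ∃ S : AutomaticStructure X, S.W.accepts = geodesicWords X

/-- The set of all word-differences that arise in the multipliers, that is, from the pairs of
words accepted by some multiplier. -/
def AutomaticStructure.multiplierDiffs (S : AutomaticStructure X) : Set G :=
  {g | ∃ (x : PadAlphabet X) (u v : List (Alphabet X)),
    pad u v ∈ (S.M x).accepts ∧ g ∈ wordDiffs u v}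

/-- The word-difference machine associated with a set `D` of group elements, with the identity
as its initial state and its only accepting state: there is a transition from `d` to `e` with
label `(x, y)` exactly when `x⁻¹ d y = e`. (At most one such `e` exists for given `d, x, y`.)
States that cannot be reached from the initial state do not influence the accepted language. -/
def wdMachine (X : Set G) (D : Set G) : NFA (PadAlphabet X × PadAlphabet X) ↥D where
  step d p := {e | (symVal p.1)⁻¹ * d.1 * symVal p.2 = e.1}
  start := {d | d.1 = 1}
  accept := {d | d.1 = 1}

/-- The language of the geodesic-equality automaton `GE` belonging to the set `D` of
word-differences: the pairs `(u, v)` accepted by the word-difference machine of `D` with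
`v ∈ L(W)` and `l(u) = l(v)`. -/
def AutomaticStructure.langGE (S : AutomaticStructure X) (D : Set G) :
    Language (PadAlphabet X × PadAlphabet X) :=
  {p | ∃ u v : List (Alphabet X), p = pad u v ∧
    pad u v ∈ (wdMachine X D).accepts ∧ v ∈ S.W.accepts ∧ u.length = v.length}

/-- The language of the geodesic word-acceptor `GW` belonging to `D`. -/
def AutomaticStructure.langGW (S : AutomaticStructure X) (D : Set G) : Language (Alphabet X) :=
  {u | ∃ v : List (Alphabet X), pad u v ∈ S.langGE D}

/-- The language of the test automaton `T` belonging to `D`. -/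
def AutomaticStructure.langT (S : AutomaticStructure X) (D : Set G) : Language (Alphabet X) :=
  {w | w ∉ S.langGW D ∧ ∃ u : List (Alphabet X),
    pad w u ∈ (wdMachine X D).accepts ∧ u ∈ S.langGW D ∧ u.length = w.length}

/-- `WD` is the sequence of sets of word-differences produced by a run of the procedure (numbered
from `0`). It starts with the word-differences of the multipliers. As long as the language of the
test automaton is non-empty, some word `w` of that language is selected (any selection is allowed),
`w` is reduced to its short-lex representative `v`, and the word-differences arising from `(w, v)`
are added. When the language of the test automaton is empty, the procedure has halted, and the
sequence is continued by the constant value. -/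
structure AutomaticStructure.IsRun (S : AutomaticStructure X) [LinearOrder (Alphabet X)]
    (WD : ℕ → Set G) : Prop where
  zero : WD 0 = S.multiplierDiffs
  succ : ∀ n, (∃ w, w ∈ S.langT (WD n)) →
    ∃ w ∈ S.langT (WD n), ∃ v ∈ shortLexWords X, eval v = eval w ∧
      WD (n + 1) = WD n ∪ wordDiffs w v
  halted : ∀ n, (¬ ∃ w, w ∈ S.langT (WD n)) → WD (n + 1) = WD n

/-- The run halts: at some stage the language of the test automaton is empty. -/
def AutomaticStructure.Halts (S : AutomaticStructure X) (WD : ℕ → Set G) : Prop :=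
  ∃ n, ∀ w, w ∉ S.langT (WD n)

end GeodAut

/-! Every word that the procedure handles is geodesic, since equal-length partners of short-lex
words are geodesic; so `GW` can only err by missing geodesics. If `T` is empty, induction on length
shows that it misses none. Let `wa` be geodesic and let `w` be matched with the short-lex word `v'`.
The multiplier of `a` bounds the differences between `v'a` and its short-lex form, so `v'a` lies in
`GW`. As `wa` and `v'a` differ along the way only as `w` and `v'` do, a missing `wa` would be
accepted by `T`. Hence the geodesics are regular, and comparing two of them through their short-lex
forms confines their differences to the finite set `D * D * D⁻¹`, which yields multipliers
(`langGW_eq_geodesicWords`, `stronglyGeodesicallyAutomatic_of_langGW_eq`).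

Conversely, in a geodesic automatic structure the identity multiplier accepts every pair `(w, v)`
that is processed. All added differences therefore lie in one finite set (`multiplierDiffs_finite`),
while each round adds a new one, so the rounds must end (`IsRun.halts`). -/

open scoped Pointwise

/-! ### Closure properties of regular languages -/

section Regular

variable {α β σ : Type*}

theorem NFA.isRegular_accepts [Finite σ] (M : NFA α σ) : M.accepts.IsRegular := by
  have := Fintype.ofFinite (Set σ)
  exact Language.isRegular_iff.2 ⟨Set σ, this, M.toDFA, M.toDFA_correct⟩

theorem DFA.isRegular_accepts [Finite σ] (M : DFA α σ) : M.accepts.IsRegular := by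
  have := Fintype.ofFinite σ
  exact Language.isRegular_iff.2 ⟨σ, this, M, rfl⟩

theorem Language.IsRegular.congr {L L' : Language α} (h : L.IsRegular)
    (hL : ∀ x, x ∈ L' ↔ x ∈ L) : L'.IsRegular :=
  Set.ext hL ▸ h

theorem Language.IsRegular.comap {L : Language β} (h : L.IsRegular) (f : α → β) :
    Language.IsRegular ({x | x.map f ∈ L} : Language α) := by
  obtain ⟨τ, _, M, rfl⟩ := h
  exact ⟨τ, ‹_›, M.comap f, M.accepts_comap f⟩

/-- The automaton reading the images of the words read by `M` under a map of alphabets. -/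
def DFA.mapNFA (M : DFA α σ) (f : α → β) : NFA β σ where
  step s b := {t | ∃ a, f a = b ∧ M.step s a = t}
  start := {M.start}
  accept := M.accept

theorem DFA.mem_eval_mapNFA (M : DFA α σ) (f : α → β) (y : List β) (t : σ) :
    t ∈ (M.mapNFA f).eval y ↔ ∃ x, x.map f = y ∧ M.eval x = t := by
  induction y using List.reverseRecOn generalizing t with
  | nil => simp [DFA.mapNFA, eq_comm]
  | append_singleton y b ih =>
    rw [NFA.eval_append_singleton, NFA.mem_stepSet]
    constructor
    · rintro ⟨s, hs, a, rfl, rfl⟩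
      obtain ⟨x, rfl, rfl⟩ := (ih s).1 hs
      exact ⟨x ++ [a], by simp, by simp⟩
    · rintro ⟨x, hx, rfl⟩
      obtain ⟨x', z, rfl, rfl, hz⟩ := List.map_eq_append_iff.1 hx
      obtain ⟨a, rfl, rfl⟩ := List.map_eq_singleton_iff.1 hz
      exact ⟨M.eval x', (ih _).2 ⟨x', rfl, rfl⟩, a, rfl, by simp⟩

theorem Language.IsRegular.image {L : Language α} (h : L.IsRegular) (f : α → β) :
    Language.IsRegular ({y | ∃ x ∈ L, x.map f = y} : Language β) := by
  obtain ⟨τ, _, M, rfl⟩ := h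
  refine Language.IsRegular.congr (M.mapNFA f).isRegular_accepts fun y => ?_
  constructor
  · rintro ⟨x, hx, rfl⟩
    exact ⟨M.eval x, hx, (M.mem_eval_mapNFA f _ _).2 ⟨x, rfl, rfl⟩⟩
  · rintro ⟨t, ht, hy⟩
    obtain ⟨x, rfl, rfl⟩ := (M.mem_eval_mapNFA f _ _).1 hy
    exact ⟨x, ht, rfl⟩

theorem Language.isRegular_forall_mem (P : α → Prop) :
    Language.IsRegular ({x | ∀ a ∈ x, P a} : Language α) := by
  let M : NFA α Unit := ⟨fun _ a => {_t | P a}, Set.univ, Set.univ⟩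
  have key (x : List α) : () ∈ M.eval x ↔ ∀ a ∈ x, P a := by
    induction x using List.reverseRecOn with
    | nil => simp [M]
    | append_singleton y b ih =>
      rw [NFA.eval_append_singleton, NFA.mem_stepSet]
      constructor
      · rintro ⟨⟨⟩, hs, hb⟩ a ha
        rcases List.mem_append.1 ha with ha | ha
        · exact ih.1 hs a ha
        · rw [List.mem_singleton.1 ha]; exact hb
      · intro h
        exact ⟨(), ih.2 fun a ha => h a (by simp [ha]), h b (by simp)⟩
  exact M.isRegular_accepts.congr fun x =>
    ⟨fun h => ⟨(), trivial, (key x).2 h⟩, fun ⟨_, _, h⟩ => (key x).1 h⟩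

/-- The automaton accepting the words accepted by `M`, filled up with `none` at their end. -/
def DFA.padNFA (M : DFA α σ) : NFA (Option α) (σ × Bool) where
  step s
    | some a => {t | s.2 = false ∧ t = (M.step s.1 a, false)}
    | none => {(s.1, true)}
  start := {(M.start, false)}
  accept := {s | s.1 ∈ M.accept}

/-- The Boolean in the state records whether padding has begun; once it has, no letter can be read.
-/
theorem DFA.mem_eval_padNFA (M : DFA α σ) (y : List (Option α)) (t : σ × Bool) :
    t ∈ M.padNFA.eval y ↔ ∃ w k, y = w.map some ++ List.replicate k none ∧ M.eval w = t.1 ∧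
      (t.2 = true ↔ k ≠ 0) := by
  induction y using List.reverseRecOn generalizing t with
  | nil =>
    rcases t with ⟨t, b⟩
    constructor
    · intro h
      obtain ⟨rfl, rfl⟩ := Prod.mk.inj h
      exact ⟨[], 0, by simp, rfl, by simp⟩
    · rintro ⟨w, k, h, h1, h2⟩
      simp at h
      obtain ⟨rfl, rfl⟩ := h
      have hb : b = false := by simpa using h2
      exact Prod.ext h1.symm hb
  | append_singleton y b ih =>
    rw [NFA.eval_append_singleton, NFA.mem_stepSet]
    constructor
    · rintro ⟨s, hs, ht⟩
      obtain ⟨w, k, rfl, hw, hk⟩ := (ih s).1 hs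
      cases b with
      | none =>
        obtain rfl : t = (s.1, true) := ht
        exact ⟨w, k + 1, by simp [List.replicate_succ'], hw, by simp⟩
      | some a =>
        obtain ⟨hs2, rfl⟩ : s.2 = false ∧ t = (M.step s.1 a, false) := ht
        have hk0 : k = 0 := by simpa [hs2] using hk
        subst hk0
        exact ⟨w ++ [a], 0, by simp, by simp [hw], by simp⟩
    · rintro ⟨w, k, h, hw, hk⟩
      cases k with
      | zero =>
        rw [List.replicate_zero, List.append_nil] at h
        obtain ⟨x', z, rfl, rfl, hz⟩ := List.map_eq_append_iff.1 h.symm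
        obtain ⟨a, rfl, rfl⟩ := List.map_eq_singleton_iff.1 hz
        refine ⟨(M.eval x', false), (ih _).2 ⟨x', 0, by simp, rfl, by simp⟩, rfl, ?_⟩
        refine Prod.ext ?_ (by simpa using hk)
        simpa using hw.symm
      | succ k =>
        rw [List.replicate_succ', ← List.append_assoc] at h
        obtain ⟨rfl, hb⟩ := List.append_inj' h rfl
        obtain rfl : b = none := by simpa using hb
        refine ⟨(t.1, decide (k ≠ 0)), (ih _).2 ⟨w, k, rfl, hw, by simp⟩, ?_⟩
        exact Prod.ext rfl (by simpa using hk)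

theorem Language.IsRegular.padded {L : Language α} (h : L.IsRegular) :
    Language.IsRegular ({y | ∃ w ∈ L, ∃ k, y = w.map some ++ List.replicate k none} :
      Language (Option α)) := by
  obtain ⟨τ, _, M, rfl⟩ := h
  refine Language.IsRegular.congr M.padNFA.isRegular_accepts fun y => ?_
  constructor
  · rintro ⟨w, hw, k, rfl⟩
    exact ⟨(M.eval w, decide (k ≠ 0)), hw,
      (M.mem_eval_padNFA _ _).2 ⟨w, k, rfl, rfl, by simp⟩⟩
  · rintro ⟨t, ht, hy⟩
    obtain ⟨w, k, rfl, hw, -⟩ := (M.mem_eval_padNFA _ _).1 hy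
    refine ⟨w, ?_, k, rfl⟩
    rw [DFA.mem_accepts, hw]
    exact ht

end Regular

namespace GeodAut

universe u

variable {G : Type u} [Group G] {X : Set G}

/-! ### Combinatorics of padded pairs -/

section Pad

@[simp] theorem pad_nil_nil : pad ([] : List (Alphabet X)) [] = [] := rfl

@[simp] theorem pad_cons_nil (a : Alphabet X) (u : List (Alphabet X)) :
    pad (a :: u) [] = (some a, none) :: pad u [] := by simp [pad]

@[simp] theorem pad_nil_cons (b : Alphabet X) (v : List (Alphabet X)) :
    pad [] (b :: v) = (none, some b) :: pad [] v := by simp [pad]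

@[simp] theorem pad_cons_cons (a b : Alphabet X) (u v : List (Alphabet X)) :
    pad (a :: u) (b :: v) = (some a, some b) :: pad u v := by simp [pad]

theorem map_fst_pad (u v : List (Alphabet X)) :
    ∃ k, (pad u v).map Prod.fst = u.map some ++ List.replicate k none := by
  induction u generalizing v with
  | nil =>
    refine ⟨v.length, ?_⟩
    induction v with
    | nil => rfl
    | cons b v ih => simpa [List.replicate_succ] using ih
  | cons a u ih =>
    cases v with
    | nil => obtain ⟨k, hk⟩ := ih []; exact ⟨k, by simp [hk]⟩
    | cons b v => obtain ⟨k, hk⟩ := ih v; exact ⟨k, by simp [hk]⟩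

theorem pad_swap (u v : List (Alphabet X)) : (pad u v).map Prod.swap = pad v u := by
  induction u generalizing v with
  | nil =>
    induction v with
    | nil => rfl
    | cons b v ih => simpa using ih
  | cons a u ih =>
    cases v with
    | nil => simpa using ih []
    | cons b v => simpa using ih v

theorem map_snd_pad (u v : List (Alphabet X)) :
    ∃ k, (pad u v).map Prod.snd = v.map some ++ List.replicate k none := by
  obtain ⟨k, hk⟩ := map_fst_pad v u
  refine ⟨k, ?_⟩
  rw [← hk, ← pad_swap u v, List.map_map]
  rfl

theorem none_none_notMem_pad (u v : List (Alphabet X)) : (none, none) ∉ pad u v := by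
  induction u generalizing v with
  | nil =>
    induction v with
    | nil => simp
    | cons b v ih => simpa using ih
  | cons a u ih =>
    cases v with
    | nil => simpa using ih []
    | cons b v => simpa using ih v

/-- Splits being a padded pair into three conditions, each recognised by a finite automaton;
`isRegular_pad` intersects them. -/
theorem eq_pad_iff (p : List (PadAlphabet X × PadAlphabet X)) (u v : List (Alphabet X)) :
    p = pad u v ↔ (∃ k, p.map Prod.fst = u.map some ++ List.replicate k none) ∧
      (∃ k, p.map Prod.snd = v.map some ++ List.replicate k none) ∧ (none, none) ∉ p := by
  refine ⟨?_, ?_⟩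
  · rintro rfl
    exact ⟨map_fst_pad u v, map_snd_pad u v, none_none_notMem_pad u v⟩
  · rintro ⟨⟨k, hk⟩, ⟨l, hl⟩, hp⟩
    induction p generalizing u v k l with
    | nil =>
      simp at hk hl
      simp [hk.1, hl.1]
    | cons c p ih =>
      obtain ⟨x, y⟩ := c
      have hp' : (none, none) ∉ p := fun h => hp (List.mem_cons_of_mem _ h)
      have hxy : ¬ (x = none ∧ y = none) := by
        rintro ⟨rfl, rfl⟩; exact hp List.mem_cons_self
      cases u with
      | nil =>
        cases k with
        | zero => simp at hk
        | succ k =>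
          cases v with
          | nil =>
            cases l with
            | zero => simp at hl
            | succ l => simp [List.replicate_succ] at hk hl; exact (hxy ⟨hk.1, hl.1⟩).elim
          | cons b v =>
            simp only [List.map_cons, List.map_nil, List.nil_append, List.replicate_succ,
              List.cons_append, List.cons.injEq] at hk hl
            rw [pad_nil_cons, hk.1, hl.1, ih [] v k (by simpa using hk.2) hp' l hl.2]
      | cons a u =>
        cases v with
        | nil =>
          cases l with
          | zero => simp at hl
          | succ l =>
            simp only [List.map_cons, List.map_nil, List.nil_append, List.replicate_succ,
              List.cons_append, List.cons.injEq] at hk hl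
            rw [pad_cons_nil, hk.1, hl.1, ih u [] k hk.2 hp' l (by simpa using hl.2)]
        | cons b v =>
          simp only [List.map_cons, List.cons_append, List.cons.injEq] at hk hl
          rw [pad_cons_cons, hk.1, hl.1, ih u v k hk.2 hp' l hl.2]

theorem reduceOption_map_fst_pad (u v : List (Alphabet X)) :
    ((pad u v).map Prod.fst).reduceOption = u := by
  obtain ⟨k, hk⟩ := map_fst_pad u v
  simp [hk, List.reduceOption_append, List.reduceOption_replicate_none]
  simp [List.reduceOption]

theorem reduceOption_map_snd_pad (u v : List (Alphabet X)) :
    ((pad u v).map Prod.snd).reduceOption = v := by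
  obtain ⟨k, hk⟩ := map_snd_pad u v
  simp [hk, List.reduceOption_append, List.reduceOption_replicate_none]
  simp [List.reduceOption]

theorem pad_inj {u v u' v' : List (Alphabet X)} (h : pad u v = pad u' v') : u = u' ∧ v = v' :=
  ⟨by rw [← reduceOption_map_fst_pad u v, h, reduceOption_map_fst_pad],
    by rw [← reduceOption_map_snd_pad u v, h, reduceOption_map_snd_pad]⟩

theorem take_pad (u v : List (Alphabet X)) (i : ℕ) :
    (pad u v).take i = pad (u.take i) (v.take i) := by
  induction i generalizing u v with
  | zero => simp
  | succ i ih =>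
    cases u <;> cases v <;> simp [ih]

theorem pad_eq_map_zip {u v : List (Alphabet X)} (h : u.length = v.length) :
    pad u v = (u.zip v).map (Prod.map some some) := by
  induction u generalizing v with
  | nil => obtain rfl := List.length_eq_zero_iff.1 h.symm; rfl
  | cons a u ih =>
    cases v with
    | nil => simp at h
    | cons b v => simp [ih (by simpa using h)]

theorem isRegular_pad {L L' : Language (Alphabet X)} (h : L.IsRegular) (h' : L'.IsRegular) :
    Language.IsRegular ({p | ∃ u v, p = pad u v ∧ u ∈ L ∧ v ∈ L'} :
      Language (PadAlphabet X × PadAlphabet X)) := by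
  refine Language.IsRegular.congr (((h.padded.comap Prod.fst).inf (h'.padded.comap Prod.snd)).inf
    (Language.isRegular_forall_mem (fun c : PadAlphabet X × PadAlphabet X => c ≠ (none, none))))
    fun p => ?_
  constructor
  · rintro ⟨u, v, hp, hu, hv⟩
    obtain ⟨h1, h2, h3⟩ := (eq_pad_iff p u v).1 hp
    exact ⟨⟨⟨u, hu, h1⟩, ⟨v, hv, h2⟩⟩, fun c hc hc' => h3 (hc' ▸ hc)⟩
  · rintro ⟨⟨⟨u, hu, h1⟩, ⟨v, hv, h2⟩⟩, h3⟩
    exact ⟨u, v, (eq_pad_iff p u v).2 ⟨h1, h2, fun hc => h3 _ hc rfl⟩, hu, hv⟩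

end Pad

/-! ### Group elements and word-differences of padded pairs -/

section Eval

/-- The element represented by a word in the padded alphabet. -/
def symEval (q : List (PadAlphabet X)) : G := (q.map symVal).prod

@[simp] theorem symEval_nil : symEval ([] : List (PadAlphabet X)) = 1 := rfl

@[simp] theorem symEval_append (q r : List (PadAlphabet X)) :
    symEval (q ++ r) = symEval q * symEval r := by simp [symEval]

@[simp] theorem symEval_singleton (x : PadAlphabet X) : symEval [x] = symVal x := by
  simp [symEval]

theorem symEval_map_some_append (u : List (Alphabet X)) (k : ℕ) :
    symEval (u.map some ++ List.replicate k none) = eval u := by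
  simp [symEval, eval, symVal, Function.comp_def]

@[simp] theorem symEval_fst_pad (u v : List (Alphabet X)) :
    symEval ((pad u v).map Prod.fst) = eval u := by
  obtain ⟨k, hk⟩ := map_fst_pad u v
  rw [hk, symEval_map_some_append]

@[simp] theorem symEval_snd_pad (u v : List (Alphabet X)) :
    symEval ((pad u v).map Prod.snd) = eval v := by
  obtain ⟨k, hk⟩ := map_snd_pad u v
  rw [hk, symEval_map_some_append]

/-- The group element by which the two components of a word of pairs differ. -/
def diff (p : List (PadAlphabet X × PadAlphabet X)) : G :=
  (symEval (p.map Prod.fst))⁻¹ * symEval (p.map Prod.snd)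

@[simp] theorem diff_pad (u v : List (Alphabet X)) : diff (pad u v) = (eval u)⁻¹ * eval v := by
  simp [diff]

@[simp] theorem eval_nil : eval ([] : List (Alphabet X)) = 1 := rfl

@[simp] theorem eval_append (u v : List (Alphabet X)) : eval (u ++ v) = eval u * eval v := by
  simp [eval]

/-- A prefix of a padded pair is the padded pair of the prefixes, so word-differences can be read
off along a run of an automaton. -/
theorem mem_wordDiffs_iff {u v : List (Alphabet X)} {g : G} :
    g ∈ wordDiffs u v ↔ ∃ i, g = diff ((pad u v).take i) := by
  simp [wordDiffs, take_pad]

theorem one_mem_wordDiffs (u v : List (Alphabet X)) : (1 : G) ∈ wordDiffs u v := ⟨0, by simp⟩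

theorem wordDiffs_finite (u v : List (Alphabet X)) : (wordDiffs u v).Finite := by
  refine ((Set.finite_Iic (max u.length v.length)).image
    fun i => (eval (u.take i))⁻¹ * eval (v.take i)).subset ?_
  rintro _ ⟨i, rfl⟩
  rcases le_total i (max u.length v.length) with h | h
  · exact ⟨i, h, rfl⟩
  · refine ⟨max u.length v.length, Set.self_mem_Iic, ?_⟩
    simp only
    rw [List.take_of_length_le (le_max_left _ _), List.take_of_length_le (le_max_right _ _),
      List.take_of_length_le ((le_max_left _ _).trans h),
      List.take_of_length_le ((le_max_right _ _).trans h)]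

end Eval

/-! ### Languages of word-difference machines -/

section WordDifferenceMachine

/-- The word-difference machine with a given accepting state. -/
def wdMachineAt (X : Set G) (D : Set G) (g : G) : NFA (PadAlphabet X × PadAlphabet X) ↥D where
  step := (wdMachine X D).step
  start := (wdMachine X D).start
  accept := {d | d.1 = g}

/-- Transitions are forced: the only state that `p` can reach is `diff p`, and the run survives
exactly as long as these differences stay in `D`. -/
theorem mem_eval_wdMachineAt (D : Set G) (g : G) (p : List (PadAlphabet X × PadAlphabet X))
    (e : ↥D) : e ∈ (wdMachineAt X D g).eval p ↔
      e.1 = diff p ∧ ∀ i, diff (p.take i) ∈ D := by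
  induction p using List.reverseRecOn generalizing e with
  | nil =>
    have h : e ∈ (wdMachineAt X D g).eval [] ↔ e.1 = 1 := Iff.rfl
    rw [h]
    simp only [diff, List.map_nil, symEval_nil, inv_one, mul_one, List.take_nil, forall_const]
    exact ⟨fun h => ⟨h, h ▸ e.2⟩, And.left⟩
  | append_singleton p c ih =>
    rw [NFA.eval_append_singleton, NFA.mem_stepSet]
    have hdiff : diff (p ++ [c]) = (symVal c.1)⁻¹ * diff p * symVal c.2 := by
      simp [diff, mul_assoc]
    constructor
    · rintro ⟨s, hs, hst⟩
      obtain ⟨h1, h2⟩ := (ih s).1 hs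
      replace hst : (symVal c.1)⁻¹ * s.1 * symVal c.2 = e.1 := hst
      rw [h1, ← hdiff] at hst
      refine ⟨hst.symm, fun i => ?_⟩
      rcases le_or_gt i p.length with hi | hi
      · rw [List.take_append_of_le_length hi]; exact h2 i
      · rw [List.take_of_length_le (by simpa using hi), hst]; exact e.2
    · rintro ⟨h1, h2⟩
      have h3 (i : ℕ) : diff (p.take i) ∈ D := by
        -- The index is capped so that the prefix of `p ++ [c]` does not include `c`.
        have := h2 (min i p.length)
        rwa [List.take_append_of_le_length (min_le_right _ _), ← List.take_eq_take_min] at this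
      have h4 : diff p ∈ D := by simpa using h3 p.length
      refine ⟨⟨diff p, h4⟩, (ih _).2 ⟨rfl, h3⟩, ?_⟩
      exact (hdiff.symm.trans h1.symm)

theorem pad_mem_accepts_wdMachineAt (D : Set G) (g : G) (u v : List (Alphabet X)) :
    pad u v ∈ (wdMachineAt X D g).accepts ↔
      eval u * g = eval v ∧ wordDiffs u v ⊆ D := by
  have hsub : wordDiffs u v ⊆ D ↔ ∀ i, diff ((pad u v).take i) ∈ D := by
    simp only [Set.subset_def, mem_wordDiffs_iff]
    exact ⟨fun h i => h _ ⟨i, rfl⟩, fun h _ ⟨i, hi⟩ => hi ▸ h i⟩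
  rw [hsub]
  constructor
  · rintro ⟨e, he, h⟩
    obtain ⟨h1, h2⟩ := (mem_eval_wdMachineAt D g _ e).1 h
    replace he : e.1 = g := he
    exact ⟨by rw [← he, h1, diff_pad, mul_inv_cancel_left], h2⟩
  · rintro ⟨h1, h2⟩
    have h3 : diff (pad u v) = g := by rw [diff_pad, ← h1, inv_mul_cancel_left]
    have h4 := h2 (pad u v).length
    rw [List.take_length] at h4
    exact ⟨⟨_, h4⟩, h3, (mem_eval_wdMachineAt D g _ _).2 ⟨rfl, h2⟩⟩

theorem pad_mem_accepts_wdMachine (D : Set G) (u v : List (Alphabet X)) :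
    pad u v ∈ (wdMachine X D).accepts ↔ eval u = eval v ∧ wordDiffs u v ⊆ D := by
  have := pad_mem_accepts_wdMachineAt D 1 u v
  rwa [mul_one] at this

end WordDifferenceMachine

/-! ### Finiteness of the multiplier differences, and regularity of the languages -/

namespace AutomaticStructure

/-- The state reached determines the difference. If `z`, with components `a` and `b`, leads from
that state to acceptance in `M x`, then `u(i) a x = v(i) b`, so the difference is `a x b⁻¹`. One
completion is chosen per state; states without one get the irrelevant value `1`. -/
theorem multiplierDiffs_finite (hfin : X.Finite) (S : AutomaticStructure X) :
    S.multiplierDiffs.Finite := by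
  have : Finite (Alphabet X) := (hfin.union hfin.inv).to_subtype
  have := S.finite_MState
  classical
  let f : (Σ x : PadAlphabet X, S.MState x) → G := fun s =>
    if h : ∃ z, (S.M s.1).evalFrom s.2 z ∈ (S.M s.1).accept then
      symEval (h.choose.map Prod.fst) * symVal s.1 * (symEval (h.choose.map Prod.snd))⁻¹ else 1
  refine (Set.finite_range f).subset ?_
  rintro g ⟨x, u, v, huv, hg⟩
  obtain ⟨i, rfl⟩ := mem_wordDiffs_iff.1 hg
  refine ⟨⟨x, (S.M x).eval ((pad u v).take i)⟩, ?_⟩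
  have hev (z) : (S.M x).eval ((pad u v).take i ++ z) =
      (S.M x).evalFrom ((S.M x).eval ((pad u v).take i)) z := DFA.evalFrom_of_append ..
  have h : ∃ z, (S.M x).evalFrom ((S.M x).eval ((pad u v).take i)) z ∈ (S.M x).accept := by
    refine ⟨(pad u v).drop i, ?_⟩
    rw [← hev, List.take_append_drop]
    exact huv
  have hz := h.choose_spec
  simp only [f, dif_pos h]
  rw [← hev] at hz
  obtain ⟨w₁, w₂, hw, -, -, h12⟩ := (S.mem_M x _).1 hz
  rw [← symEval_fst_pad w₁ w₂, ← symEval_snd_pad w₁ w₂, ← hw, List.map_append, List.map_append,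
    symEval_append, symEval_append] at h12
  rw [diff, eq_inv_mul_iff_mul_eq, ← mul_assoc, mul_inv_eq_iff_eq_mul, ← mul_assoc]
  exact h12

variable (S : AutomaticStructure X) (D : Set G)

theorem mem_langGW {u : List (Alphabet X)} : u ∈ S.langGW D ↔
    ∃ v ∈ S.W.accepts, u.length = v.length ∧ eval u = eval v ∧ wordDiffs u v ⊆ D := by
  constructor
  · rintro ⟨v, u', v', h, hm, hv, hl⟩
    obtain ⟨rfl, rfl⟩ := pad_inj h
    exact ⟨v, hv, hl, (pad_mem_accepts_wdMachine D u v).1 hm⟩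
  · rintro ⟨v, hv, hl, hm⟩
    exact ⟨v, u, v, rfl, (pad_mem_accepts_wdMachine D u v).2 hm, hv, hl⟩

theorem mem_langT {w : List (Alphabet X)} : w ∈ S.langT D ↔ w ∉ S.langGW D ∧
    ∃ u ∈ S.langGW D, u.length = w.length ∧ eval w = eval u ∧ wordDiffs w u ⊆ D := by
  constructor
  · rintro ⟨h, u, hm, hu, hl⟩
    exact ⟨h, u, hu, hl, (pad_mem_accepts_wdMachine D w u).1 hm⟩
  · rintro ⟨h, u, hu, hl, hm⟩
    exact ⟨h, u, (pad_mem_accepts_wdMachine D w u).2 hm, hu, hl⟩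

variable {S D}

theorem isRegular_W : S.W.accepts.IsRegular :=
  have := S.finite_WState
  S.W.isRegular_accepts

/-- Pairs of equal length need no padding, so they can be treated as words over the product
alphabet. -/
theorem isRegular_zip (hD : D.Finite) {L : Language (Alphabet X)} (hL : L.IsRegular) :
    Language.IsRegular ({z | z.map (Prod.map some some) ∈ (wdMachine X D).accepts ∧
      z.map Prod.snd ∈ L} : Language (Alphabet X × Alphabet X)) :=
  have := hD.to_subtype
  ((wdMachine X D).isRegular_accepts.comap _).inf (hL.comap _)

theorem pad_unzip (z : List (Alphabet X × Alphabet X)) :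
    pad (z.map Prod.fst) (z.map Prod.snd) = z.map (Prod.map some some) := by
  rw [pad_eq_map_zip (by simp), ← List.unzip_fst, ← List.unzip_snd, List.zip_unzip]

theorem isRegular_langGE (hD : D.Finite) : (S.langGE D).IsRegular := by
  refine Language.IsRegular.congr ((isRegular_zip hD S.isRegular_W).image (Prod.map some some))
    fun p => ?_
  constructor
  · rintro ⟨u, v, rfl, hm, hv, hl⟩
    refine ⟨u.zip v, ⟨?_, ?_⟩, (pad_eq_map_zip hl).symm⟩
    · rwa [← pad_eq_map_zip hl]
    · rwa [List.map_snd_zip hl.ge]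
  · rintro ⟨z, ⟨hm, hv⟩, rfl⟩
    refine ⟨z.map Prod.fst, z.map Prod.snd, (pad_unzip z).symm, ?_, hv, by simp⟩
    rwa [pad_unzip]

theorem isRegular_fst (hD : D.Finite) {L : Language (Alphabet X)} (hL : L.IsRegular) :
    Language.IsRegular ({u | ∃ v, pad u v ∈ (wdMachine X D).accepts ∧ v ∈ L ∧
      u.length = v.length} : Language (Alphabet X)) := by
  refine Language.IsRegular.congr ((isRegular_zip hD hL).image Prod.fst) fun u => ?_
  constructor
  · rintro ⟨v, hm, hv, hl⟩
    refine ⟨u.zip v, ⟨?_, ?_⟩, List.map_fst_zip hl.le⟩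
    · rwa [← pad_eq_map_zip hl]
    · rwa [List.map_snd_zip hl.ge]
  · rintro ⟨z, ⟨hm, hv⟩, rfl⟩
    refine ⟨z.map Prod.snd, ?_, hv, by simp⟩
    rwa [pad_unzip]

theorem isRegular_langGW (hD : D.Finite) : (S.langGW D).IsRegular := by
  refine Language.IsRegular.congr (isRegular_fst hD S.isRegular_W) fun u => ?_
  constructor
  · rintro ⟨v, u', v', h, hm, hv, hl⟩
    obtain ⟨rfl, rfl⟩ := pad_inj h
    exact ⟨v, hm, hv, hl⟩
  · rintro ⟨v, hm, hv, hl⟩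
    exact ⟨v, u, v, rfl, hm, hv, hl⟩

theorem isRegular_langT (hD : D.Finite) : (S.langT D).IsRegular := by
  refine Language.IsRegular.congr ((isRegular_langGW (S := S) hD).compl.inf
    (isRegular_fst hD (isRegular_langGW (S := S) hD))) fun u => ?_
  constructor
  · rintro ⟨h, v, hm, hv, hl⟩
    exact ⟨h, v, hm, hv, hl.symm⟩
  · rintro ⟨h, v, hm, hv, hl⟩
    exact ⟨h, v, hm, hv, hl.symm⟩

theorem wordDiffs_subset_multiplierDiffs {u v : List (Alphabet X)} (hu : u ∈ S.W.accepts)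
    (hv : v ∈ S.W.accepts) (x : PadAlphabet X) (h : eval u * symVal x = eval v) :
    wordDiffs u v ⊆ S.multiplierDiffs := fun _ hg =>
  ⟨x, u, v, (S.mem_M x _).2 ⟨u, v, rfl, hu, hv, h⟩, hg⟩

theorem one_mem_multiplierDiffs : (1 : G) ∈ S.multiplierDiffs := by
  obtain ⟨w, hw, -⟩ := S.exists_rep 1
  exact wordDiffs_subset_multiplierDiffs hw hw none (by simp [symVal]) (one_mem_wordDiffs w w)

end AutomaticStructure

/-! ### Geodesic and short-lex words -/

section Geodesic

theorem mem_geodesicWords_of_eq {u v : List (Alphabet X)} (hv : v ∈ geodesicWords X)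
    (hl : u.length = v.length) (he : eval u = eval v) : u ∈ geodesicWords X :=
  fun w hw => hl ▸ hv w (hw.trans he)

theorem length_eq_of_mem_geodesicWords {u v : List (Alphabet X)} (hu : u ∈ geodesicWords X)
    (hv : v ∈ geodesicWords X) (he : eval u = eval v) : u.length = v.length :=
  le_antisymm (hu v he.symm) (hv u he)

theorem mem_geodesicWords_of_append {u v : List (Alphabet X)} (h : u ++ v ∈ geodesicWords X) :
    u ∈ geodesicWords X := fun w hw => by
  have := h (w ++ v) (by simp [hw])
  simpa using this

variable [LinearOrder (Alphabet X)]

theorem shortLexWords_subset_geodesicWords {w : List (Alphabet X)} (hw : w ∈ shortLexWords X) :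
    w ∈ geodesicWords X := fun v hv => by
  rcases hw v hv with rfl | h
  · exact le_rfl
  · rcases List.shortlex_def.1 h with h | h
    · exact h.le
    · exact h.1.le

end Geodesic

/-! ### Correctness and termination of the procedure -/

namespace AutomaticStructure

variable [LinearOrder (Alphabet X)] {S : AutomaticStructure X} {D : Set G}

theorem langGW_subset_geodesicWords (hS : S.W.accepts = shortLexWords X)
    {u : List (Alphabet X)} (hu : u ∈ S.langGW D) : u ∈ geodesicWords X := by
  obtain ⟨v, hv, hl, he, -⟩ := (S.mem_langGW D).1 hu
  exact mem_geodesicWords_of_eq (shortLexWords_subset_geodesicWords (hS ▸ hv)) hl he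

theorem langT_subset_geodesicWords (hS : S.W.accepts = shortLexWords X)
    {w : List (Alphabet X)} (hw : w ∈ S.langT D) : w ∈ geodesicWords X := by
  obtain ⟨-, u, hu, hl, he, -⟩ := (S.mem_langT D).1 hw
  exact mem_geodesicWords_of_eq (langGW_subset_geodesicWords hS hu) hl.symm he

/-- If the test automaton accepts nothing, then the geodesic word-acceptor is correct. -/
theorem langGW_eq_geodesicWords (hS : S.W.accepts = shortLexWords X)
    (hD : S.multiplierDiffs ⊆ D) (hT : ∀ w, w ∉ S.langT D) :
    S.langGW D = geodesicWords X := by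
  ext w
  refine ⟨langGW_subset_geodesicWords hS, fun hw => ?_⟩
  have h1 : (1 : G) ∈ D := hD one_mem_multiplierDiffs
  induction w using List.reverseRecOn with
  | nil =>
    obtain ⟨v, hv, he⟩ := S.exists_rep 1
    have hl : v.length = 0 := by
      have := shortLexWords_subset_geodesicWords (hS ▸ hv) [] (by rw [he, eval_nil])
      simpa using this
    obtain rfl := List.length_eq_zero_iff.1 hl
    refine (S.mem_langGW D).2 ⟨[], hv, rfl, rfl, ?_⟩
    rintro _ ⟨i, rfl⟩
    simpa using h1
  | append_singleton w a ih =>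
    obtain ⟨v', hv', hl', he', hd'⟩ := (S.mem_langGW D).1 (ih (mem_geodesicWords_of_append hw))
    by_contra hcon
    refine hT (w ++ [a]) ((S.mem_langT D).2 ⟨hcon, v' ++ [a], ?_, by simp [hl'],
      by simp [he'], ?_⟩)
    -- `v' ++ [a]` lies in `GW`: its differences with `v` are those of `(v', v)`, which the
    -- multiplier of `a` supplies, until both words end together at difference `1`.
    · obtain ⟨v, hv, he⟩ := S.exists_rep (eval (v' ++ [a]))
      have hea : eval v' * symVal (some a) = eval v := by
        rw [he, eval_append]
        simp [symVal, eval]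
      have hl : (w ++ [a]).length = v.length := length_eq_of_mem_geodesicWords hw
        (shortLexWords_subset_geodesicWords (hS ▸ hv)) (by simp [he, he'])
      have hl2 : (v' ++ [a]).length = v.length := by rw [← hl]; simp [hl']
      refine (S.mem_langGW D).2 ⟨v, hv, hl2, he.symm, ?_⟩
      rintro _ ⟨i, rfl⟩
      rcases le_or_gt i v'.length with hi | hi
      · rw [List.take_append_of_le_length hi]
        exact hD (wordDiffs_subset_multiplierDiffs hv' hv (some a) hea ⟨i, rfl⟩)
      · have hi' : (v' ++ [a]).length ≤ i := by simpa using hi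
        rw [List.take_of_length_le hi', List.take_of_length_le (hl2 ▸ hi'), he, inv_mul_cancel]
        exact h1
    · rintro _ ⟨i, rfl⟩
      rcases le_or_gt i w.length with hi | hi
      · rw [List.take_append_of_le_length hi, List.take_append_of_le_length (hl' ▸ hi)]
        exact hd' ⟨i, rfl⟩
      · have hi' : (w ++ [a]).length ≤ i := by simpa using hi
        rw [List.take_of_length_le hi', List.take_of_length_le (by simpa [← hl'] using hi')]
        simpa [he'] using h1

/-- A finite set of word-differences with correct geodesic word-acceptor gives an automatic
structure on the geodesic words. -/
theorem stronglyGeodesicallyAutomatic_of_langGW_eq (hS : S.W.accepts = shortLexWords X)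
    (hfin : D.Finite) (hD : S.multiplierDiffs ⊆ D) (hGW : S.langGW D = geodesicWords X) :
    StronglyGeodesicallyAutomatic X := by
  have hreg : (geodesicWords X).IsRegular := hGW ▸ isRegular_langGW hfin
  -- With short-lex partners `u'`, `v'`, the difference of `(u, v)` at `i` is the product of those
  -- of `(u, u')`, `(u', v')` and the inverse of that of `(v, v')`.
  have hE : (D * D * D⁻¹).Finite := (hfin.mul hfin).mul hfin.inv
  have hM (x : PadAlphabet X) : Language.IsRegular ({p | ∃ u v, p = pad u v ∧
      u ∈ geodesicWords X ∧ v ∈ geodesicWords X ∧ eval u * symVal x = eval v} :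
      Language (PadAlphabet X × PadAlphabet X)) := by
    have := hE.to_subtype
    refine Language.IsRegular.congr ((isRegular_pad hreg hreg).inf
      (wdMachineAt X (D * D * D⁻¹) (symVal x)).isRegular_accepts) fun p => ?_
    constructor
    · rintro ⟨u, v, rfl, hu, hv, he⟩
      refine ⟨⟨u, v, rfl, hu, hv⟩, (pad_mem_accepts_wdMachineAt _ _ u v).2 ⟨he, ?_⟩⟩
      obtain ⟨u', hu', -, heu, hdu⟩ := (S.mem_langGW D).1 (hGW ▸ hu)
      obtain ⟨v', hv', -, hev, hdv⟩ := (S.mem_langGW D).1 (hGW ▸ hv)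
      have hd := wordDiffs_subset_multiplierDiffs hu' hv' x (by rw [← heu, ← hev, he])
      rintro _ ⟨i, rfl⟩
      refine Set.mem_mul.2 ⟨_, Set.mul_mem_mul (hdu ⟨i, rfl⟩) (hD (hd ⟨i, rfl⟩)), _,
        Set.inv_mem_inv.2 (hdv ⟨i, rfl⟩), ?_⟩
      group
    · rintro ⟨⟨u, v, rfl, hu, hv⟩, hm⟩
      exact ⟨u, v, rfl, hu, hv, ((pad_mem_accepts_wdMachineAt _ _ u v).1 hm).1⟩
  obtain ⟨τ, _, W, hW⟩ := hreg
  choose σ hσ M hM using hM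
  refine ⟨⟨τ, inferInstance, W, fun g => ?_, σ, fun x => Finite.of_fintype (σ x), M,
    fun x p => ?_⟩, hW⟩
  · obtain ⟨w, hw, he⟩ := S.exists_rep g
    exact ⟨w, hW ▸ shortLexWords_subset_geodesicWords (hS ▸ hw), he⟩
  · rw [hM, hW]
    rfl

theorem exists_shortLex (hS : S.W.accepts = shortLexWords X) (g : G) :
    ∃ v ∈ shortLexWords X, eval v = g := by
  rw [← hS]
  exact S.exists_rep g

theorem exists_isRun (hS : S.W.accepts = shortLexWords X) : ∃ WD : ℕ → Set G, S.IsRun WD := by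
  have hnext (D : Set G) : ∃ D' : Set G,
      ((∃ w, w ∈ S.langT D) → ∃ w ∈ S.langT D, ∃ v ∈ shortLexWords X, eval v = eval w ∧
        D' = D ∪ wordDiffs w v) ∧ ((¬ ∃ w, w ∈ S.langT D) → D' = D) := by
    by_cases h : ∃ w, w ∈ S.langT D
    · obtain ⟨w, hw⟩ := h
      obtain ⟨v, hv, he⟩ := exists_shortLex hS (eval w)
      exact ⟨_, fun _ => ⟨w, hw, v, hv, he, rfl⟩, fun h => (h ⟨w, hw⟩).elim⟩
    · exact ⟨D, fun h' => (h h').elim, fun _ => rfl⟩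
  choose next h1 h2 using hnext
  exact ⟨fun n => next^[n] S.multiplierDiffs, rfl,
    fun n h => by simpa only [Function.iterate_succ_apply'] using h1 _ h,
    fun n h => by simpa only [Function.iterate_succ_apply'] using h2 _ h⟩

namespace IsRun

variable {WD : ℕ → Set G}

theorem subset_succ (h : S.IsRun WD) (n : ℕ) : WD n ⊆ WD (n + 1) := by
  by_cases hn : ∃ w, w ∈ S.langT (WD n)
  · obtain ⟨w, -, v, -, -, he⟩ := h.succ n hn
    exact he ▸ Set.subset_union_left
  · exact (h.halted n hn).ge

theorem multiplierDiffs_subset (h : S.IsRun WD) (n : ℕ) : S.multiplierDiffs ⊆ WD n :=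
  h.zero ▸ monotone_nat_of_le_succ h.subset_succ (Nat.zero_le n)

theorem finite (hfin : X.Finite) (h : S.IsRun WD) (n : ℕ) : (WD n).Finite := by
  induction n with
  | zero => exact h.zero ▸ S.multiplierDiffs_finite hfin
  | succ n ih =>
    by_cases hn : ∃ w, w ∈ S.langT (WD n)
    · obtain ⟨w, -, v, -, -, he⟩ := h.succ n hn
      exact he ▸ ih.union (wordDiffs_finite w v)
    · exact (h.halted n hn).symm ▸ ih

theorem halts (hfin : X.Finite) (hS : S.W.accepts = shortLexWords X) (h : S.IsRun WD)
    (hG : StronglyGeodesicallyAutomatic X) : S.Halts WD := by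
  obtain ⟨S', hS'⟩ := hG
  by_contra hcon
  simp only [Halts, not_exists, not_forall, not_not] at hcon
  have hstep (n : ℕ) : WD n ⊂ WD (n + 1) ∧ WD (n + 1) ⊆ WD n ∪ S'.multiplierDiffs := by
    obtain ⟨w, hw, v, hv, he, hn⟩ := h.succ n (hcon n)
    have hwg := langT_subset_geodesicWords hS hw
    have hvg := shortLexWords_subset_geodesicWords hv
    -- If nothing new were added, the differences of `(w, v)` would already be in `WD n`, and `v`
    -- would witness `w` in `GW`, which `T` excludes.
    refine ⟨(h.subset_succ n).ssubset_of_ne fun heq => ?_, ?_⟩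
    · refine ((S.mem_langT _).1 hw).1 ((S.mem_langGW _).2 ⟨v, hS ▸ hv,
        length_eq_of_mem_geodesicWords hwg hvg he.symm, he.symm, ?_⟩)
      rw [heq, hn]
      exact Set.subset_union_right
    · rw [hn]
      exact Set.union_subset_union_right _ (wordDiffs_subset_multiplierDiffs (hS' ▸ hwg)
        (hS' ▸ hvg) none (by simp [symVal, he]))
  have hbound (n : ℕ) : WD n ⊆ WD 0 ∪ S'.multiplierDiffs := by
    induction n with
    | zero => exact Set.subset_union_left
    | succ n ih => exact (hstep n).2.trans (Set.union_subset ih Set.subset_union_right)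
  have hmono : StrictMono WD := strictMono_nat_of_lt_succ fun n => (hstep n).1
  -- A finite set has only finitely many subsets, so the strictly increasing sequence cannot be
  -- infinite.
  exact Set.infinite_range_of_injective hmono.injective
    (((h.finite hfin 0).union (S'.multiplierDiffs_finite hfin)).finite_subsets.subset
      (Set.range_subset_iff.2 hbound))

end IsRun

end AutomaticStructure

end GeodAut

/-- For a group with a short-lex automatic structure `S`, the verification procedure can be run;
along every run all the sets of word-differences are finite and all the languages involved are
regular (so that the automata exist at every stage); and every run halts if and only if the group
is strongly geodesically automatic. -/
theorem mainTheorem1 {G : Type*} [Group G] (X : Set G) (hfin : X.Finite)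
    (hgen : Subgroup.closure X = ⊤) [LinearOrder (GeodAut.Alphabet X)]
    (S : GeodAut.AutomaticStructure X) (hS : S.W.accepts = GeodAut.shortLexWords X) :
    (∃ WD : ℕ → Set G, S.IsRun WD) ∧
    ∀ WD : ℕ → Set G, S.IsRun WD →
      (∀ n, (WD n).Finite ∧ (S.langGE (WD n)).IsRegular ∧ (S.langGW (WD n)).IsRegular ∧
        (S.langT (WD n)).IsRegular) ∧
      (S.Halts WD ↔ GeodAut.StronglyGeodesicallyAutomatic X) := by
  refine ⟨GeodAut.AutomaticStructure.exists_isRun hS, fun WD h => ⟨fun n => ?_, ?_, ?_⟩⟩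
  · have hn := h.finite hfin n
    exact ⟨hn, GeodAut.AutomaticStructure.isRegular_langGE hn,
      GeodAut.AutomaticStructure.isRegular_langGW hn, GeodAut.AutomaticStructure.isRegular_langT hn⟩
  · rintro ⟨n, hn⟩
    have hD := h.multiplierDiffs_subset n
    exact GeodAut.AutomaticStructure.stronglyGeodesicallyAutomatic_of_langGW_eq hS
      (h.finite hfin n) hD (GeodAut.AutomaticStructure.langGW_eq_geodesicWords hS hD hn)
  · exact h.halts hfin hS
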